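/- Let $A_1$ be the complex Weyl algebra, i.e. the unital associative $\mathbb{C}$-algebra generated by $a$ and $a^\dagger$ with $aa^\dagger-a^\dagger a=1$, equipped with the conjugate-linear involutive anti-automorphism $\dagger$ that exchanges $a$ and $a^\dagger$. Let $\hat A_1=\{p\in A_1 : p^\dagger=-p\}$, a real Lie algebra under the commutator. For integers $\alpha\ge\beta\ge0$ put $$g_+^{(\alpha,\beta)}=i\big((a^\dagger)^\beta a^\alpha+(a^\dagger)^\alpha a^\beta\big),\qquad g_-^{(\alpha,\beta)}=(a^\dagger)^\beta a^\alpha-(a^\dagger)^\alpha a^\beta ,$$ with $\alpha>\beta$ required for $g_-^{(\alpha,\beta)}$. These elements form a real basis of $\hat A_1$; equip $\hat A_1$ with the scalar product for which they are orthonormal. Consider the real subspaces $$\hat A_1^0=\langle g_+^{(0,0)},g_+^{(1,1)}\rangle,\quad \hat A_1^1=\langle g_+^{(1,0)},g_-^{(1,0)}\rangle,\quad \hat A_1^2=\langle g_+^{(2,0)},g_-^{(2,0)}\rangle,$$ $$\hat A_1^= =\langle g_+^{(k,k)} : k\ge2\rangle,\quad \hat A_1^\perp=\langle g_\pm^{(\alpha,\beta)}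 : \alpha>\beta,\ \alpha+\beta\ge3\rangle ,$$ so that $\hat A_1=\hat A_1^0\oplus\hat A_1^1\oplus\hat A_1^2\oplus\hat A_1^=\oplus\hat A_1^\perp$. For $W$ a sum of some of these subspaces, let $\mathcal P_W$ be the orthogonal projection onto $W$, and $\mathcal P_W(\mathcal G)=\{\mathcal P_W(e) : e\in\mathcal G\}$ for a set $\mathcal G\subseteq\hat A_1$. Theorem. Let $c\in\mathbb{R}$ and let $\mathcal G\subseteq\hat A_1$ be a finite set containing $ia^\dagger a+ic$. Then the real Lie subalgebra $\langle\mathcal G\rangle_{\mathrm{Lie}}$ of $\hat A_1$ generated by $\mathcal G$ is finite-dimensional if and only if both of the following hold: (i) $\mathcal P_{\hat A_1^\perp}(\mathcal G)=\{0\}$; (ii) if $\mathcal P_{\hat A_1^=}(\mathcal G)\neq\{0\}$, then $\mathcal P_{\hat A_1^1\oplus\hat A_1^2}(\mathcal G)=\{0\}$. -/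

import Mathlib

open scoped ComplexConjugate

/-! ### The single-mode complex Weyl algebra -/

/-- The canonical commutation relation on the free algebra on two letters, where the letter
`false` stands for the annihilation operator `a` and `true` for the creation operator `a†`. -/
inductive CCRel : FreeAlgebra ℂ Bool → FreeAlgebra ℂ Bool → Prop
  | comm : CCRel
      (FreeAlgebra.ι ℂ false * FreeAlgebra.ι ℂ true)
      (FreeAlgebra.ι ℂ true * FreeAlgebra.ι ℂ false + 1)

/-- The complex Weyl algebra `A₁`: the associative unital `ℂ`-algebra generated by `a` and `a†`
subject to `a a† - a† a = 1`. -/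
def Weyl : Type := RingQuot CCRel

namespace Weyl

noncomputable instance : Ring Weyl := inferInstanceAs (Ring (RingQuot CCRel))
noncomputable instance : Algebra ℂ Weyl := inferInstanceAs (Algebra ℂ (RingQuot CCRel))

/-- The quotient map from the free algebra. -/
noncomputable def mk : FreeAlgebra ℂ Bool →ₐ[ℂ] Weyl := RingQuot.mkAlgHom ℂ CCRel

/-- The annihilation operator `a`. -/
noncomputable def a : Weyl := mk (FreeAlgebra.ι ℂ false)

/-- The creation operator `a†`. -/
noncomputable def ad : Weyl := mk (FreeAlgebra.ι ℂ true)

theorem a_mul_ad : a * ad = ad * a + 1 := by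
  have h := RingQuot.mkAlgHom_rel ℂ CCRel.comm
  have h' : mk (FreeAlgebra.ι ℂ false * FreeAlgebra.ι ℂ true)
      = mk (FreeAlgebra.ι ℂ true * FreeAlgebra.ι ℂ false + 1) := h
  simpa [a, ad] using h'

/-- The universal property of the Weyl algebra. -/
noncomputable def lift {B : Type*} [Ring B] [Algebra ℂ B] (x y : B) (h : x * y = y * x + 1) :
    Weyl →ₐ[ℂ] B :=
  RingQuot.liftAlgHom ℂ ⟨FreeAlgebra.lift ℂ (fun b => bif b then y else x), by
    rintro _ _ ⟨⟩
    simpa using h⟩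

theorem lift_mk {B : Type*} [Ring B] [Algebra ℂ B] (x y : B) (h : x * y = y * x + 1)
    (z : FreeAlgebra ℂ Bool) :
    lift x y h (mk z) = FreeAlgebra.lift ℂ (fun b => bif b then y else x) z :=
  RingQuot.liftAlgHom_mkAlgHom_apply _ _ _ _

@[simp] theorem lift_a {B : Type*} [Ring B] [Algebra ℂ B] (x y : B) (h : x * y = y * x + 1) :
    lift x y h a = x := by
  simp [a, lift_mk]

@[simp] theorem lift_ad {B : Type*} [Ring B] [Algebra ℂ B] (x y : B) (h : x * y = y * x + 1) :
    lift x y h ad = y := by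
  simp [ad, lift_mk]

theorem algHom_ext {B : Type*} [Semiring B] [Algebra ℂ B] {f g : Weyl →ₐ[ℂ] B}
    (ha : f a = g a) (had : f ad = g ad) : f = g := by
  refine RingQuot.ringQuot_ext' (S := ℂ) f g ?_
  refine FreeAlgebra.hom_ext ?_
  funext b
  cases b
  · exact ha
  · exact had

/-! ### The dagger operation -/

/-- The opposite algebra of `A₁` with complex conjugate scalars. -/
def ConjOp : Type := Weylᵐᵒᵖ

noncomputable instance : Ring ConjOp := inferInstanceAs (Ring Weylᵐᵒᵖ)

noncomputable instance : Algebra ℂ ConjOp :=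
  RingHom.toAlgebra' (((algebraMap ℂ Weylᵐᵒᵖ).comp (starRingEnd ℂ) : ℂ →+* Weylᵐᵒᵖ))
    (fun c x => Algebra.commutes (A := Weylᵐᵒᵖ) (conj c) x)

/-- The dagger operation, as a `ℂ`-algebra homomorphism to the conjugate opposite algebra:
the unique conjugate-linear anti-endomorphism exchanging `a` and `a†`. -/
noncomputable def daggerHom : Weyl →ₐ[ℂ] ConjOp :=
  lift (B := ConjOp) (MulOpposite.op ad : Weylᵐᵒᵖ) (MulOpposite.op a : Weylᵐᵒᵖ) (by
    show (MulOpposite.op ad * MulOpposite.op a : Weylᵐᵒᵖ)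
      = MulOpposite.op a * MulOpposite.op ad + 1
    rw [← MulOpposite.op_mul, ← MulOpposite.op_mul, a_mul_ad]; rfl)

/-- `p†`. -/
noncomputable def dagger (p : Weyl) : Weyl := MulOpposite.unop (daggerHom p : Weylᵐᵒᵖ)

theorem dagger_a : dagger a = ad := by
  exact congrArg MulOpposite.unop
    (lift_a (B := ConjOp) (MulOpposite.op ad : Weylᵐᵒᵖ) (MulOpposite.op a : Weylᵐᵒᵖ) _)

theorem dagger_ad : dagger ad = a := by
  exact congrArg MulOpposite.unop
    (lift_ad (B := ConjOp) (MulOpposite.op ad : Weylᵐᵒᵖ) (MulOpposite.op a : Weylᵐᵒᵖ) _)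

theorem dagger_mul (p q : Weyl) : dagger (p * q) = dagger q * dagger p := by
  unfold dagger; rw [map_mul]; rfl

theorem dagger_add (p q : Weyl) : dagger (p + q) = dagger p + dagger q := by
  unfold dagger; rw [map_add]; rfl

theorem dagger_algebraMap (c : ℂ) :
    dagger (algebraMap ℂ Weyl c) = algebraMap ℂ Weyl (conj c) := by
  unfold dagger; rw [AlgHom.commutes]; rfl

theorem dagger_dagger (p : Weyl) : dagger (dagger p) = p := by
  let f : Weyl →ₐ[ℂ] Weyl :=
    { toFun := fun p => dagger (dagger p)
      map_one' := by
        have h := dagger_algebraMap 1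
        simp only [map_one] at h
        rw [h, h]
      map_mul' := fun p q => by rw [dagger_mul, dagger_mul]
      map_zero' := by
        have h := dagger_algebraMap 0
        simp only [map_zero] at h
        rw [h, h]
      map_add' := fun p q => by rw [dagger_add, dagger_add]
      commutes' := fun c => by rw [dagger_algebraMap, dagger_algebraMap, Complex.conj_conj] }
  have hf : f = AlgHom.id ℂ Weyl := by
    apply algHom_ext
    · show dagger (dagger a) = a
      rw [dagger_a, dagger_ad]
    · show dagger (dagger ad) = ad
      rw [dagger_ad, dagger_a]
  exact DFunLike.congr_fun hf p

noncomputable instance : StarRing Weyl where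
  star := dagger
  star_involutive := dagger_dagger
  star_mul := dagger_mul
  star_add := dagger_add

theorem star_a : star a = ad := dagger_a
theorem star_ad : star ad = a := dagger_ad

instance : StarModule ℂ Weyl where
  star_smul c p := by
    rw [Algebra.smul_def, star_mul, Algebra.smul_def, Algebra.commutes]
    congr 1
    exact dagger_algebraMap c

/-! ### Normally ordered monomials form a basis of the complex Weyl algebra -/

/-- The normally ordered monomial `(a†)^α a^β`, for the multi-index `γ = (α, β)`. -/
noncomputable def mono (γ : ℕ × ℕ) : Weyl := ad ^ γ.1 * a ^ γ.2

theorem star_mono (γ : ℕ × ℕ) : star (mono γ) = mono γ.swap := by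
  simp [mono, star_a, star_ad]

theorem a_mul_ad_pow (n : ℕ) : a * ad ^ n = ad ^ n * a + (n : Weyl) * ad ^ (n - 1) := by
  induction n with
  | zero => simp
  | succ n ih =>
    rw [pow_succ, ← mul_assoc, ih, add_mul, mul_assoc, a_mul_ad, mul_add, mul_one, mul_assoc,
      ← pow_succ, mul_assoc]
    rcases n with _ | n
    · simp
    · simp only [Nat.add_sub_cancel]
      push_cast
      rw [add_mul ((n : Weyl) + 1) 1, one_mul, add_assoc, add_comm (ad ^ (n + 1))]

theorem span_mono : Submodule.span ℂ (Set.range mono) = ⊤ := by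
  set S := Submodule.span ℂ (Set.range mono) with hS
  have had : ∀ s ∈ S, ad * s ∈ S := by
    intro s hs
    induction hs using Submodule.span_induction with
    | mem x hx =>
      obtain ⟨γ, rfl⟩ := hx
      refine Submodule.subset_span ⟨(γ.1 + 1, γ.2), ?_⟩
      simp only [mono]; rw [pow_succ', mul_assoc]
    | zero => simp
    | add x y _ _ hx hy => rw [mul_add]; exact S.add_mem hx hy
    | smul c x _ hx => rw [mul_smul_comm]; exact S.smul_mem c hx
  have ha : ∀ s ∈ S, a * s ∈ S := by
    intro s hs
    induction hs using Submodule.span_induction with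
    | mem x hx =>
      obtain ⟨γ, rfl⟩ := hx
      have h : a * mono γ = mono (γ.1, γ.2 + 1) + (γ.1 : ℂ) • mono (γ.1 - 1, γ.2) := by
        simp only [mono]
        rw [← mul_assoc, a_mul_ad_pow, add_mul, mul_assoc, ← pow_succ', mul_assoc,
          Algebra.smul_def, map_natCast]
      rw [h]
      exact S.add_mem (Submodule.subset_span ⟨_, rfl⟩)
        (S.smul_mem _ (Submodule.subset_span ⟨_, rfl⟩))
    | zero => simp
    | add x y _ _ hx hy => rw [mul_add]; exact S.add_mem hx hy
    | smul c x _ hx => rw [mul_smul_comm]; exact S.smul_mem c hx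
  have key : ∀ z : FreeAlgebra ℂ Bool, ∀ s ∈ S, mk z * s ∈ S := by
    intro z
    induction z using FreeAlgebra.induction with
    | grade0 c =>
      intro s hs
      rw [AlgHom.commutes, ← Algebra.smul_def]
      exact S.smul_mem c hs
    | grade1 b =>
      cases b
      · exact ha
      · exact had
    | mul x y hx hy =>
      intro s hs
      rw [map_mul, mul_assoc]
      exact hx _ (hy _ hs)
    | add x y hx hy =>
      intro s hs
      rw [map_add, add_mul]
      exact S.add_mem (hx _ hs) (hy _ hs)
  have h1 : (1 : Weyl) ∈ S := Submodule.subset_span ⟨(0, 0), by simp [mono]⟩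
  rw [eq_top_iff]
  rintro p -
  obtain ⟨z, rfl⟩ := RingQuot.mkAlgHom_surjective ℂ CCRel p
  have := key z 1 h1
  rwa [mul_one] at this

/-- The action of `A₁` on polynomials: `a` is `d/dX`, and `a†` is multiplication by `X`. -/
noncomputable def rep : Weyl →ₐ[ℂ] Module.End ℂ (Polynomial ℂ) :=
  lift Polynomial.derivative (LinearMap.mulLeft ℂ Polynomial.X) (by
    refine LinearMap.ext fun p => ?_
    simp [Polynomial.derivative_mul, add_comm])

theorem rep_mono (γ : ℕ × ℕ) (p : Polynomial ℂ) :
    rep (mono γ) p = Polynomial.X ^ γ.1 * Polynomial.derivative^[γ.2] p := by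
  simp [rep, mono, LinearMap.pow_mulLeft, Module.End.pow_apply]

theorem linearIndependent_mono : LinearIndependent ℂ mono := by
  rw [linearIndependent_iff]
  intro l hl
  have key : ∀ β α : ℕ, l (α, β) = 0 := by
    intro β
    induction β using Nat.strong_induction_on with
    | _ β ih =>
      intro α
      have h := congrArg (fun w => (rep w (Polynomial.X ^ β)).coeff α) hl
      simp only [Finsupp.linearCombination_apply, Finsupp.sum, map_sum, map_smul,
        LinearMap.sum_apply, LinearMap.smul_apply, rep_mono, Polynomial.finsetSum_coeff,
        Polynomial.coeff_smul, map_zero, LinearMap.zero_apply, Polynomial.coeff_zero] at h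
      rw [Finset.sum_eq_single (α, β)] at h
      · simp only [Polynomial.iterate_derivative_X_pow_eq_smul, Nat.descFactorial_self,
          Nat.sub_self, pow_zero] at h
        rw [mul_smul_comm, mul_one, Polynomial.coeff_smul, Polynomial.coeff_X_pow_self] at h
        simpa [Nat.factorial_ne_zero] using h
      · rintro ⟨α', β'⟩ - hne
        rcases lt_trichotomy β' β with hlt | rfl | hgt
        · rw [ih β' hlt α', zero_smul]
        · have hα : α ≠ α' := fun e => hne (by rw [e])
          rw [Polynomial.iterate_derivative_X_pow_eq_smul, Nat.sub_self, pow_zero, mul_smul_comm,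
            mul_one, Polynomial.coeff_smul, Polynomial.coeff_X_pow, if_neg hα]
          simp
        · rw [Polynomial.iterate_derivative_X_pow_eq_smul,
            Nat.descFactorial_eq_zero_iff_lt.2 hgt]
          simp
      · intro hns
        rw [Finsupp.notMem_support_iff.1 hns, zero_smul]
  ext ⟨α, β⟩
  exact key β α

/-- The canonical basis `(a†)^α a^β` of `A₁`. -/
noncomputable def monoBasis : Module.Basis (ℕ × ℕ) ℂ Weyl :=
  Module.Basis.mk linearIndependent_mono span_mono.ge

@[simp] theorem monoBasis_apply (γ : ℕ × ℕ) : monoBasis γ = mono γ := by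
  simp [monoBasis]

/-! ### The skew-hermitian Weyl algebra -/

/-- The Lie bracket on `A₁` is the commutator `[p, q] = p q - q p`. -/
noncomputable instance : LieRing Weyl := LieRing.ofAssociativeRing
noncomputable instance : LieAlgebra ℝ Weyl := LieAlgebra.ofAssociativeAlgebra

/-- The skew-hermitian Weyl algebra `Â₁`: the real Lie algebra of all `p ∈ A₁` with `p† = -p`,
with the commutator as Lie bracket. -/
noncomputable def Skew : LieSubalgebra ℝ Weyl where
  carrier := {p | star p = -p}
  add_mem' := fun {p q} hp hq => by
    simp only [Set.mem_ofPred_eq] at *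
    rw [star_add, hp, hq, neg_add]
  zero_mem' := by simp
  smul_mem' := fun r p hp => by
    simp only [Set.mem_ofPred_eq] at *
    rw [star_smul, hp, star_trivial, smul_neg]
  lie_mem' := fun {p q} hp hq => by
    have hp' : star p = -p := hp
    have hq' : star q = -q := hq
    show star ⁅p, q⁆ = -⁅p, q⁆
    rw [Ring.lie_def, star_sub, star_mul, star_mul, hp', hq']
    noncomm_ring

/-- `g₊^γ = i ((a^γ)† + a^γ)`. -/
noncomputable def gPlus (γ : ℕ × ℕ) : Skew :=
  ⟨Complex.I • (star (mono γ) + mono γ), by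
    show star (Complex.I • (star (mono γ) + mono γ)) = -(Complex.I • (star (mono γ) + mono γ))
    rw [star_smul, star_add, star_star, Complex.star_def, Complex.conj_I, neg_smul,
      add_comm (mono γ)]⟩

/-- `g₋^γ = (a^γ)† - a^γ`. -/
noncomputable def gMinus (γ : ℕ × ℕ) : Skew :=
  ⟨star (mono γ) - mono γ, by
    show star (star (mono γ) - mono γ) = -(star (mono γ) - mono γ)
    rw [star_sub, star_star, neg_sub]⟩

/-- The labels `(σ, (α, β))` of the monomials `g_σ^(α, β)` of `Â₁`, with `true` for `σ = +` and
`false` for `σ = -`: one requires `α ≥ β` if `σ = +` and `α > β` if `σ = -`. -/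
abbrev Label : Type :=
  {x : Bool × (ℕ × ℕ) // x.2.2 ≤ x.2.1 ∧ (x.1 = false → x.2.2 < x.2.1)}

/-- The monomials `g_σ^γ` of `Â₁`. -/
noncomputable def gen (i : Label) : Skew := bif i.1.1 then gPlus i.1.2 else gMinus i.1.2

/-- The real functional on `Â₁` reading off the coefficient of `g_σ^γ`, in terms of the complex
coefficient of `(a†)^α a^β`. -/
noncomputable def coeffFun (i : Label) : Skew →ₗ[ℝ] ℝ where
  toFun p := bif i.1.1 then (monoBasis.repr (p : Weyl) i.1.2).im / (if i.1.2.1 = i.1.2.2 then 2 else 1)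
    else -(monoBasis.repr (p : Weyl) i.1.2).re
  map_add' p q := by
    rcases i with ⟨⟨_ | _, γ⟩, h⟩
    · simp [add_comm]
    · simp [add_div]
  map_smul' r p := by
    have h : monoBasis.repr ((r • p : Skew) : Weyl) i.1.2
        = (r : ℂ) * monoBasis.repr (p : Weyl) i.1.2 := by
      have : ((r • p : Skew) : Weyl) = (r : ℂ) • (p : Weyl) := rfl
      rw [this, map_smul]; rfl
    rw [h]
    rcases i with ⟨⟨_ | _, γ⟩, h⟩
    · simp
    · simp [mul_div_assoc]

theorem repr_gPlus (γ δ : ℕ × ℕ) : monoBasis.repr (gPlus γ : Weyl) δ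
    = Complex.I * ((if γ.swap = δ then 1 else 0) + (if γ = δ then 1 else 0)) := by
  have : (gPlus γ : Weyl) = Complex.I • (monoBasis γ.swap + monoBasis γ) := by
    rw [monoBasis_apply, monoBasis_apply, ← star_mono]; rfl
  rw [this, map_smul, map_add, Module.Basis.repr_self, Module.Basis.repr_self]
  simp [Finsupp.single_apply, mul_add]

theorem repr_gMinus (γ δ : ℕ × ℕ) : monoBasis.repr (gMinus γ : Weyl) δ
    = (if γ.swap = δ then 1 else 0) - (if γ = δ then 1 else 0) := by
  have : (gMinus γ : Weyl) = monoBasis γ.swap - monoBasis γ := by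
    rw [monoBasis_apply, monoBasis_apply, ← star_mono]; rfl
  rw [this, map_sub, Module.Basis.repr_self, Module.Basis.repr_self]
  simp [Finsupp.single_apply]

theorem coeffFun_gen_self (i : Label) : coeffFun i (gen i) = 1 := by
  rcases i with ⟨⟨_ | _, α, β⟩, h1, h2⟩
  · have h : β ≠ α := (h2 rfl).ne
    simp [coeffFun, gen, repr_gMinus, Prod.swap, h]
  · by_cases h : α = β
    · subst h
      simp [coeffFun, gen, repr_gPlus, Prod.swap]
    · have h3 : β ≠ α := fun e => h e.symm
      simp [coeffFun, gen, repr_gPlus, Prod.swap, h, h3]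

theorem coeffFun_gen_of_ne (i j : Label) (hij : i ≠ j) : coeffFun i (gen j) = 0 := by
  rcases i with ⟨⟨s, α, β⟩, h1, h2⟩
  rcases j with ⟨⟨t, α', β'⟩, h1', h2'⟩
  have hne : ¬ (s = t ∧ α = α' ∧ β = β') := by
    rintro ⟨rfl, rfl, rfl⟩
    exact hij rfl
  cases s <;> cases t <;>
    simp only [coeffFun, gen, repr_gPlus, repr_gMinus, Prod.swap, Prod.mk.injEq, LinearMap.coe_mk,
      AddHom.coe_mk, cond_true, cond_false, true_and, forall_const, reduceCtorEq, false_and,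
      not_false_eq_true] at hne h1 h2 h1' h2' ⊢ <;>
    split_ifs <;> first | omega | simp

theorem linearIndependent_gen : LinearIndependent ℝ gen :=
  LinearIndependent.of_pairwise_dual_eq_zero_one gen coeffFun
    (fun i j hij => coeffFun_gen_of_ne i j hij) coeffFun_gen_self

theorem gPlus_mem_span (γ : ℕ × ℕ) : gPlus γ ∈ Submodule.span ℝ (Set.range gen) := by
  rcases le_total γ.2 γ.1 with h | h
  · exact Submodule.subset_span ⟨⟨(true, γ), h, by simp⟩, rfl⟩
  · have e : gPlus γ = gPlus γ.swap := by
      apply Subtype.ext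
      simp [gPlus, star_mono, add_comm]
    rw [e]
    exact Submodule.subset_span ⟨⟨(true, γ.swap), h, by simp⟩, rfl⟩

theorem gMinus_mem_span (γ : ℕ × ℕ) : gMinus γ ∈ Submodule.span ℝ (Set.range gen) := by
  rcases lt_trichotomy γ.2 γ.1 with h | h | h
  · exact Submodule.subset_span ⟨⟨(false, γ), h.le, fun _ => h⟩, rfl⟩
  · have e : gMinus γ = 0 := by
      apply Subtype.ext
      rcases γ with ⟨α, β⟩
      obtain rfl : β = α := h
      simp [gMinus, star_mono]
    rw [e]
    exact Submodule.zero_mem _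
  · have e : gMinus γ = -gMinus γ.swap := by
      apply Subtype.ext
      simp [gMinus, star_mono]
    rw [e]
    exact Submodule.neg_mem _ (Submodule.subset_span ⟨⟨(false, γ.swap), h.le, fun _ => h⟩, rfl⟩)

theorem span_gen : Submodule.span ℝ (Set.range gen) = ⊤ := by
  -- the skew-hermitian part of every element of the Weyl algebra is in the span
  have key : ∀ p : Weyl, ∃ q ∈ Submodule.span ℝ (Set.range gen), (q : Weyl) = p - star p := by
    intro p
    have mem : ∀ l : ℕ × ℕ →₀ ℂ, ∃ q ∈ Submodule.span ℝ (Set.range gen),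
        (q : Weyl) = monoBasis.repr.symm l - star (monoBasis.repr.symm l) := by
      intro l
      induction l using Finsupp.induction_linear with
      | zero => exact ⟨0, Submodule.zero_mem _, by simp⟩
      | add f g hf hg =>
        obtain ⟨u, hu, hu'⟩ := hf
        obtain ⟨v, hv, hv'⟩ := hg
        refine ⟨u + v, Submodule.add_mem _ hu hv, ?_⟩
        rw [show ((u + v : Skew) : Weyl) = u + v from rfl, hu', hv', map_add, star_add]
        abel
      | single γ c =>
        refine ⟨c.im • gPlus γ + (-c.re) • gMinus γ,
          Submodule.add_mem _ (Submodule.smul_mem _ _ (gPlus_mem_span γ))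
            (Submodule.smul_mem _ _ (gMinus_mem_span γ)), ?_⟩
        rw [Module.Basis.repr_symm_single, monoBasis_apply, star_smul, Complex.star_def]
        show (c.im : ℂ) • (Complex.I • (star (mono γ) + mono γ))
          + ((-c.re : ℝ) : ℂ) • (star (mono γ) - mono γ) = _
        have e1 : conj c = (c.re : ℂ) - c.im * Complex.I := by
          apply Complex.ext <;> simp
        have e2 : c • mono γ = ((c.re : ℂ) + c.im * Complex.I) • mono γ := by
          rw [Complex.re_add_im]
        rw [e1, e2]
        push_cast
        module
    simpa using mem (monoBasis.repr p)
  rw [eq_top_iff]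
  rintro p -
  obtain ⟨q, hq, hq'⟩ := key ((1 / 2 : ℝ) • (p : Weyl))
  have e : q = p := by
    apply Subtype.ext
    have hp : star (p : Weyl) = -p := p.2
    rw [hq', star_smul, star_trivial, hp, smul_neg, sub_neg_eq_add, ← add_smul]
    norm_num
  rwa [← e]

/-- The monomials `g_σ^γ` as a basis of the real vector space `Â₁`. -/
noncomputable def genBasis : Module.Basis Label ℝ Skew :=
  Module.Basis.mk linearIndependent_gen span_gen.ge

@[simp] theorem genBasis_apply (i : Label) : genBasis i = gen i := by
  simp [genBasis]

/-! ### Decomposition and projections -/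

/-- The scalar product `⟨v | w⟩` on `Â₁` for which the monomials `g_σ^γ` are orthonormal. -/
noncomputable def scalarProd : Skew →ₗ[ℝ] Skew →ₗ[ℝ] ℝ :=
  genBasis.constr ℝ fun i => genBasis.coord i

theorem scalarProd_gen_right (v : Skew) (i : Label) :
    scalarProd v (gen i) = genBasis.repr v i := by
  classical
  have h : scalarProd.flip (gen i) = genBasis.coord i := by
    refine genBasis.ext fun j => ?_
    rw [LinearMap.flip_apply, scalarProd, Module.Basis.constr_basis, ← genBasis_apply i,
      Module.Basis.coord_apply, Module.Basis.coord_apply, Module.Basis.repr_self,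
      Module.Basis.repr_self, Finsupp.single_apply, Finsupp.single_apply]
    simp only [eq_comm]
  exact DFunLike.congr_fun h v

theorem scalarProd_gen_gen [DecidableEq Label] (i j : Label) :
    scalarProd (gen i) (gen j) = if i = j then 1 else 0 := by
  rw [scalarProd_gen_right, ← genBasis_apply, Module.Basis.repr_self, Finsupp.single_apply]

/-- The coordinate subspace of `Â₁` spanned by the monomials with label in `S`. -/
noncomputable def space (S : Set Label) : Submodule ℝ Skew := Submodule.span ℝ (gen '' S)

/-- The orthogonal projection of `v` onto `space S`, that is `∑_{g} ⟨v | g⟩ g`, where `g` runs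
over the orthonormal basis of `space S` given by the monomials with label in `S`. -/
noncomputable def proj (S : Set Label) (v : Skew) : Skew :=
  ∑ᶠ i ∈ S, scalarProd v (gen i) • gen i

open Classical in
theorem proj_eq_sum (S : Set Label) (v : Skew) :
    proj S v = ∑ i ∈ (genBasis.repr v).support with i ∈ S, genBasis.repr v i • gen i := by
  unfold proj
  rw [finsum_mem_eq_sum_of_inter_support_eq]
  · exact Finset.sum_congr rfl fun i _ => by rw [scalarProd_gen_right]
  · ext i
    simp only [Set.mem_inter_iff, Function.mem_support, scalarProd_gen_right, Finset.coe_filter,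
      Finsupp.mem_support_iff, Set.mem_ofPred_eq]
    constructor
    · rintro ⟨h1, h2⟩
      exact ⟨⟨fun h => h2 (by rw [h, zero_smul]), h1⟩, h2⟩
    · rintro ⟨⟨_, h1⟩, h2⟩
      exact ⟨h1, h2⟩

open Classical in
theorem repr_proj (S : Set Label) (v : Skew) (i : Label) :
    genBasis.repr (proj S v) i = if i ∈ S then genBasis.repr v i else 0 := by
  rw [proj_eq_sum, map_sum, Finsupp.finsetSum_apply]
  simp only [map_smul, ← genBasis_apply, Module.Basis.repr_self, Finsupp.smul_apply,
    Finsupp.single_apply, smul_eq_mul, mul_ite, mul_one, mul_zero]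
  rw [Finset.sum_ite_eq']
  by_cases h : i ∈ S <;> simp [h]
  exact fun h => h.symm

theorem proj_mem_space (S : Set Label) (v : Skew) : proj S v ∈ space S := by
  classical
  rw [proj_eq_sum]
  refine Submodule.sum_mem _ fun i hi => Submodule.smul_mem _ _ (Submodule.subset_span ⟨i, ?_, rfl⟩)
  exact (Finset.mem_filter.1 hi).2

theorem scalarProd_sub_proj (S : Set Label) (v w : Skew) (hw : w ∈ space S) :
    scalarProd (v - proj S v) w = 0 := by
  unfold space at hw
  induction hw using Submodule.span_induction with
  | mem x hx =>
    obtain ⟨i, hi, rfl⟩ := hx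
    rw [scalarProd_gen_right, map_sub, Finsupp.sub_apply, repr_proj, if_pos hi, sub_self]
  | zero => simp
  | add x y _ _ hx hy => rw [map_add, hx, hy, add_zero]
  | smul c x _ hx => rw [map_smul, hx, smul_zero]

/-- Labels of the basis `{i = g₊^(0,0) / 2, i a†a = g₊^(1,1) / 2}` of `Â₁⁰` (up to scaling). -/
def labels0 : Set Label := {i | i.1.2 = (0, 0) ∨ i.1.2 = (1, 1)}

/-- Labels of the basis `{i (a + a†) = g₊^(1,0), a - a† = g₋^(1,0)}` of `Â₁¹`. -/
def labels1 : Set Label := {i | i.1.2 = (1, 0)}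

/-- Labels of the basis `{i (a² + (a†)²) = g₊^(2,0), a² - (a†)² = g₋^(2,0)}` of `Â₁²`. -/
def labels2 : Set Label := {i | i.1.2 = (2, 0)}

/-- Labels of the basis `{2 i (a†)^k a^k = g₊^(k,k) | k ≥ 2}` of the Kerr-type space `Â₁⁼`. -/
def labelsEq : Set Label := {i | ∃ k, 2 ≤ k ∧ i.1.2 = (k, k)}

/-- Labels of the basis `{g_σ^(α,β) | α > β, α + β ≥ 3}` of `Â₁^⊥`. -/
def labelsPerp : Set Label := {i | i.1.2.2 < i.1.2.1 ∧ 3 ≤ i.1.2.1 + i.1.2.2}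

/-- The free Hamiltonian term `i a†a + i c`. -/
noncomputable def freeTerm (c : ℝ) : Skew :=
  ⟨Complex.I • (ad * a) + (Complex.I * (c : ℂ)) • (1 : Weyl), by
    show star (Complex.I • (ad * a) + (Complex.I * (c : ℂ)) • (1 : Weyl))
      = -(Complex.I • (ad * a) + (Complex.I * (c : ℂ)) • (1 : Weyl))
    simp only [star_add, star_smul, star_mul, star_a, star_ad, star_one, Complex.star_def,
      Complex.conj_I, Complex.conj_ofReal, neg_smul, neg_add, mul_neg]
    rw [mul_comm (c : ℂ)]⟩

end Weyl

/-! Write N = a†a. Under the commutator with N, the monomial (a†)^α a^β is an eigenvector of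
eigenvalue (weight) α - β, and the elements of weight -k are exactly the p(N) a^k with p a
polynomial.

Suppose the generated Lie algebra is finite-dimensional. Its complex span V is finite-dimensional
and closed under commutators and †. Because i a†a + ic is a generator, V is also closed under
commutation with N, so it contains the weight components of its elements
(`exists_aeval_mul_a_pow_mem`). If D(N) lies in V with deg D ≥ 2, commuting p(N) a^k with D(N)
multiplies p by D(X + k) - D. For k ≠ 0 this factor is not constant, so a nonzero p would produce
polynomials of unbounded degree (`eq_zero_of_aeval_num_mem`). This gives (ii). For (i), let x = p(N)
a^k with k ≠ 0 and 2 deg p + k ≥ 3. Then [x, x†] is a polynomial in N of degree 2 deg p + k - 1 ≥ 2,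
which the previous argument excludes (`eq_zero_of_aeval_mul_a_pow_mem`).

Conversely, (i) and (ii) leave two cases. Either every generator has degree at most two in a and a†,
and such elements form a finite-dimensional Lie algebra (`commutator_quadratic`), or every generator
is a polynomial in N, and then all generators commute. -/

open Polynomial in
/-- A nonzero shift difference lowers the degree of a polynomial by exactly one. -/
theorem Polynomial.coeff_taylor_sub_ne_zero (F : ℂ[X]) (r : ℂ) (hr : r ≠ 0) (d : ℕ)
    (hd : F.natDegree = d + 1) : (taylor r F - F).coeff d ≠ 0 := by
  have h0 : F.coeff (d + 1) ≠ 0 := by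
    rw [← hd]
    exact leadingCoeff_ne_zero.2 (fun h => by simp [h] at hd)
  -- The coefficient is the sum of `i.choose d * F.coeff i * r ^ (i - d)`; terms with `i < d`
  -- vanish, so only `i = d` and `i = d + 1` remain.
  have h : (taylor r F).coeff d = F.coeff d + (d + 1) * F.coeff (d + 1) * r := by
    rw [taylor_coeff, hasseDeriv_apply, F.sum_over_range' _ (d + 2) (by omega),
      Finset.sum_range_succ, Finset.sum_range_succ, Finset.sum_eq_zero]
    · simp
    · intro i hi
      rw [Nat.choose_eq_zero_of_lt (Finset.mem_range.1 hi)]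
      simp
    · simp
  rw [coeff_sub, h, add_sub_cancel_left]
  exact mul_ne_zero (mul_ne_zero (by exact_mod_cast d.succ_ne_zero) h0) hr

theorem SemiconjBy.aeval {R A : Type*} [CommSemiring R] [Semiring A] [Algebra R A] {u x y : A}
    (h : SemiconjBy u x y) (q : Polynomial R) :
    SemiconjBy u (Polynomial.aeval x q) (Polynomial.aeval y q) := by
  induction q using Polynomial.induction_on' with
  | add p q hp hq => simpa using hp.add_right hq
  | monomial n c =>
    rw [Polynomial.aeval_monomial, Polynomial.aeval_monomial]
    exact SemiconjBy.mul_right (Algebra.commutes c u).symm (h.pow_right n)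

/-- A subspace invariant under a linear map contains every summand of each of its elements that
is a sum of eigenvectors with distinct eigenvalues. -/
theorem Submodule.mem_of_sum_eigenvectors_mem {K E ι : Type*} [Field K] [AddCommGroup E]
    [Module K E] (V : Submodule K E) (f : E →ₗ[K] E) (hf : ∀ x ∈ V, f x ∈ V) (μ : ι → K)
    (hμ : Function.Injective μ) (s : Finset ι) :
    ∀ x : ι → E, (∀ k ∈ s, f (x k) = μ k • x k) → ∑ k ∈ s, x k ∈ V → ∀ k ∈ s, x k ∈ V := by
  classical
  induction s using Finset.induction_on with
  | empty => simp
  | insert j s hj ih =>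
    intro x hx hsum
    -- Applying `f - μ j` kills the summand `x j` and rescales the others by nonzero factors.
    have h1 : ∑ k ∈ s, (μ k - μ j) • x k ∈ V := by
      have h2 := V.sub_mem (hf _ hsum) (V.smul_mem (μ j) hsum)
      rw [map_sum, Finset.smul_sum, ← Finset.sum_sub_distrib,
        Finset.sum_congr rfl (fun k hk => by rw [hx k hk, ← sub_smul]),
        Finset.sum_insert hj, sub_self, zero_smul, zero_add] at h2
      exact h2
    have h3 : ∀ k ∈ s, x k ∈ V := by
      intro k hk
      have h4 := ih (fun k => (μ k - μ j) • x k)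
        (fun k hk => by rw [map_smul, hx k (Finset.mem_insert_of_mem hk), smul_comm]) h1 k hk
      refine (V.smul_mem_iff (sub_ne_zero.2 fun e => hj ?_)).1 h4
      rwa [← hμ e]
    intro k hk
    rcases Finset.mem_insert.1 hk with rfl | hk
    · rw [Finset.sum_insert hj] at hsum
      exact (V.add_mem_iff_left (V.sum_mem h3)).1 hsum
    · exact h3 k hk

/-! ### Calculus of the number operator -/

namespace Weyl

open Polynomial (aeval taylor)

/-- The number operator `a†a`. -/
noncomputable def num : Weyl := ad * a

theorem star_num : star num = num := by
  rw [num, star_mul, star_a, star_ad]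

theorem semiconjBy_a_pow (k : ℕ) : SemiconjBy (a ^ k) num (num + (k : Weyl)) := by
  induction k with
  | zero => simp
  | succ k ih =>
    have h : SemiconjBy a num (num + 1) := by
      rw [SemiconjBy, num, ← mul_assoc, a_mul_ad]
    have h2 := (h.add_right (Nat.cast_commute k a).symm).mul_left ih
    rw [pow_succ', Nat.cast_succ, add_comm (k : Weyl), ← add_assoc]
    exact h2

theorem semiconjBy_ad_pow (k : ℕ) : SemiconjBy (ad ^ k) (num + (k : Weyl)) num := by
  induction k with
  | zero => simp
  | succ k ih =>
    have h : SemiconjBy ad (num + 1) num := by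
      rw [SemiconjBy, num, mul_assoc, a_mul_ad]
    have h2 := ih.mul_left (h.add_right (Nat.cast_commute k ad).symm)
    rw [pow_succ, Nat.cast_succ, add_comm (k : Weyl), ← add_assoc]
    exact h2

/-- Shifts of N are encoded as Taylor shifts of polynomials, so that identities in the Weyl algebra
become identities of polynomials. -/
theorem aeval_num_taylor (k : ℕ) (q : Polynomial ℂ) :
    aeval num (taylor (k : ℂ) q) = aeval (num + (k : Weyl)) q := by
  rw [Polynomial.taylor_apply, Polynomial.aeval_comp]
  simp

theorem a_pow_mul_aeval (k : ℕ) (q : Polynomial ℂ) :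
    a ^ k * aeval num q = aeval num (taylor (k : ℂ) q) * a ^ k := by
  rw [aeval_num_taylor]
  exact (semiconjBy_a_pow k).aeval q

theorem ad_pow_mul_aeval (k : ℕ) (q : Polynomial ℂ) :
    ad ^ k * aeval num (taylor (k : ℂ) q) = aeval num q * ad ^ k := by
  rw [aeval_num_taylor]
  exact (semiconjBy_ad_pow k).aeval q

/-- This is N(N - 1)⋯(N - k + 1), by induction from (a†)^k N = (N - k)(a†)^k. -/
theorem ad_pow_mul_a_pow (k : ℕ) : ad ^ k * a ^ k = aeval num (descPochhammer ℂ k) := by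
  induction k with
  | zero => simp
  | succ k ih =>
    have h : ad ^ k * num = (num - (k : Weyl)) * ad ^ k := by
      have := semiconjBy_ad_pow k
      rw [SemiconjBy, mul_add, ← (Nat.cast_commute k (ad ^ k)).eq] at this
      rw [sub_mul, ← this, add_sub_cancel_right]
    have e : ad ^ (k + 1) * a ^ (k + 1) = ad ^ k * num * a ^ k := by
      rw [pow_succ ad, pow_succ' a, num]
      simp only [mul_assoc]
    rw [e, h, mul_assoc, ih, descPochhammer_succ_right, mul_comm, map_mul]
    simp

/-- The opposite order gives (N + 1)⋯(N + k), which is the previous polynomial shifted by k. -/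
theorem a_pow_mul_ad_pow (k : ℕ) :
    a ^ k * ad ^ k = aeval num (taylor (k : ℂ) (descPochhammer ℂ k)) := by
  induction k with
  | zero => simp
  | succ k ih =>
    have e : a ^ (k + 1) * ad ^ (k + 1) = a ^ k * (num + 1) * ad ^ k := by
      rw [pow_succ a, pow_succ' ad, num, ← a_mul_ad]
      simp only [mul_assoc]
    have h : a ^ k * (num + 1) = (num + (k : Weyl) + 1) * a ^ k := by
      rw [mul_add, add_mul, (semiconjBy_a_pow k).eq, mul_one, one_mul]
    rw [e, h, mul_assoc, ih, aeval_num_taylor, aeval_num_taylor, descPochhammer_succ_left, map_mul,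
      Polynomial.aeval_comp]
    simp only [Nat.cast_succ, map_sub, Polynomial.aeval_X, map_one, ← add_assoc,
      add_sub_cancel_right]

/-- Identifies monomials of weight -k with polynomials in N; the exponent `m` becomes the degree. -/
theorem mono_add_right (m k : ℕ) :
    mono (m, m + k) = aeval num (descPochhammer ℂ m) * a ^ k := by
  rw [mono, pow_add, ← mul_assoc, ad_pow_mul_a_pow]

theorem num_mul_mono_sub (γ : ℕ × ℕ) :
    num * mono γ - mono γ * num = ((γ.1 : ℂ) - γ.2) • mono γ := by
  have h1 := (semiconjBy_ad_pow γ.1).eq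
  have h2 := (semiconjBy_a_pow γ.2).eq
  have c1 := (Nat.cast_commute γ.1 (ad ^ γ.1)).eq
  have c2 := (Nat.cast_commute γ.2 (ad ^ γ.1)).eq
  rw [sub_smul, Algebra.smul_def, Algebra.smul_def, map_natCast, map_natCast, mono,
    ← mul_assoc, ← h1, mul_assoc (ad ^ γ.1) (a ^ γ.2) num, h2, ← mul_assoc _ (ad ^ γ.1),
    ← mul_assoc _ (ad ^ γ.1), c1, c2]
  noncomm_ring

theorem rep_num_X_pow (n : ℕ) :
    rep num (Polynomial.X ^ n) = (n : ℂ) • (Polynomial.X ^ n : Polynomial ℂ) := by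
  have h := rep_mono (1, 1) (Polynomial.X ^ n)
  simp only [mono, pow_one] at h
  rw [num, h]
  rcases n with _ | n
  · simp
  · simp [Polynomial.smul_eq_C_mul]
    ring

theorem rep_aeval_num_X_pow (q : Polynomial ℂ) (n : ℕ) :
    rep (aeval num q) (Polynomial.X ^ n) = q.eval (n : ℂ) • (Polynomial.X ^ n : Polynomial ℂ) := by
  rw [← Polynomial.aeval_algHom_apply]
  exact Module.End.aeval_apply_of_hasEigenvector
    ⟨Module.End.mem_eigenspace_iff.2 (rep_num_X_pow n), pow_ne_zero _ Polynomial.X_ne_zero⟩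

/-- In the polynomial representation the element sends X^(n+k) to a nonzero multiple of q(n) X^n, so
q vanishes at every natural number. -/
theorem aeval_num_mul_a_pow_eq_zero {q : Polynomial ℂ} {k : ℕ} (h : aeval num q * a ^ k = 0) :
    q = 0 := by
  have hroot : ∀ n : ℕ, q.IsRoot (n : ℂ) := by
    intro n
    have h1 := congrArg (fun w => rep w (Polynomial.X ^ (n + k))) h
    have h2 := rep_mono (0, k) (Polynomial.X ^ (n + k))
    simp only [mono, pow_zero, one_mul] at h2
    simp only [map_mul, Module.End.mul_apply, h2, Polynomial.iterate_derivative_X_pow_eq_smul,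
      add_tsub_cancel_right, map_smul, rep_aeval_num_X_pow, map_zero, LinearMap.zero_apply] at h1
    have h3 : (n + k).descFactorial k ≠ 0 := by
      rw [Ne, Nat.descFactorial_eq_zero_iff_lt]
      omega
    simpa [h3] using h1
  refine Polynomial.eq_zero_of_infinite_isRoot q
    ((Set.infinite_range_of_injective (Nat.cast_injective (R := ℂ))).mono ?_)
  rintro _ ⟨n, rfl⟩
  exact hroot n

theorem star_aeval_num (q : Polynomial ℂ) :
    star (aeval num q) = aeval num (q.map (starRingEnd ℂ)) := by
  induction q using Polynomial.induction_on' with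
  | add p q hp hq => simp [hp, hq]
  | monomial n c =>
    rw [Polynomial.map_monomial, Polynomial.aeval_monomial, Polynomial.aeval_monomial, star_mul,
      star_pow, star_num, Algebra.commutes]
    congr 1
    exact dagger_algebraMap c

/-- With F = X(X - 1)⋯(X - k + 1) · (pq)(X - k), the product with (a†)^k on the left is F(N), and
the one with a^k on the left is F(N + k). -/
theorem commutator_aeval_mul_a_pow (p q : Polynomial ℂ) (k : ℕ) :
    aeval num p * a ^ k * (ad ^ k * aeval num q) - ad ^ k * aeval num q * (aeval num p * a ^ k)
      = aeval num (taylor (k : ℂ) (descPochhammer ℂ k * taylor (-(k : ℂ)) (p * q))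
          - descPochhammer ℂ k * taylor (-(k : ℂ)) (p * q)) := by
  have ht : taylor (k : ℂ) (taylor (-(k : ℂ)) (p * q)) = p * q := by
    rw [Polynomial.taylor_taylor]; simp
  have h1 : aeval num p * a ^ k * (ad ^ k * aeval num q)
      = aeval num p * (a ^ k * ad ^ k) * aeval num q := by
    simp only [mul_assoc]
  have h2 : ad ^ k * aeval num q * (aeval num p * a ^ k)
      = ad ^ k * aeval num (taylor (k : ℂ) (taylor (-(k : ℂ)) (p * q))) * a ^ k := by
    rw [ht, mul_comm p q, map_mul]
    simp only [mul_assoc]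
  rw [h1, h2, a_pow_mul_ad_pow, ad_pow_mul_aeval, mul_assoc _ (ad ^ k), ad_pow_mul_a_pow,
    ← map_mul, ← map_mul, ← map_mul, ← map_sub, Polynomial.taylor_mul _ (descPochhammer ℂ k), ht]
  congr 1
  ring

/-! ### Weight components and the degree obstruction -/

section Components

variable {V : Submodule ℂ Weyl}

/-- A subspace invariant under `ad (a†a)` contains the weight components of its elements. -/
theorem exists_aeval_mul_a_pow_mem (hN : ∀ x ∈ V, num * x - x * num ∈ V) {x : Weyl} (hx : x ∈ V)
    {m k : ℕ} (hm : monoBasis.repr x (m, m + k) ≠ 0) :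
    ∃ p : Polynomial ℂ, p ≠ 0 ∧ m ≤ p.natDegree ∧ aeval num p * a ^ k ∈ V := by
  classical
  let f : Weyl →ₗ[ℂ] Weyl := LinearMap.mulLeft ℂ num - LinearMap.mulRight ℂ num
  let c := monoBasis.repr x
  let w : ℕ × ℕ → ℤ := fun γ => (γ.1 : ℤ) - γ.2
  -- `y j` is the component of `x` of weight `j`; the one needed has weight `-k`.
  let y : ℤ → Weyl := fun j => ∑ γ ∈ c.support with w γ = j, c γ • mono γ
  have hy : ∑ j ∈ c.support.image w, y j = x := by
    rw [Finset.sum_fiberwise_of_maps_to (fun γ hγ => Finset.mem_image_of_mem w hγ)]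
    conv_rhs => rw [← monoBasis.linearCombination_repr x]
    simp [Finsupp.linearCombination_apply, Finsupp.sum, c]
  have hmem := V.mem_of_sum_eigenvectors_mem f hN (fun j : ℤ => (j : ℂ)) Int.cast_injective
    (c.support.image w) y (fun j _ => by
      simp only [y, map_sum, Finset.smul_sum]
      refine Finset.sum_congr rfl fun γ hγ => ?_
      rw [map_smul]
      show c γ • (num * mono γ - mono γ * num) = _
      rw [num_mul_mono_sub, smul_comm, ← (Finset.mem_filter.1 hγ).2]
      simp [w]) (by rwa [hy]) (-(k : ℤ))
    (Finset.mem_image.2 ⟨(m, m + k), Finsupp.mem_support_iff.2 hm, by simp [w]⟩)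
  set s := c.support.filter fun γ => w γ = -(k : ℤ) with hs
  have hsk : ∀ γ ∈ s, γ = (γ.1, γ.1 + k) := by
    intro γ hγ
    have := (Finset.mem_filter.1 hγ).2
    ext
    · rfl
    · simp only [w] at this ⊢
      omega
  let p : Polynomial ℂ := ∑ γ ∈ s, c γ • descPochhammer ℂ γ.1
  have hdeg : ∀ γ ∈ s, (c γ • descPochhammer ℂ γ.1).degree = γ.1 := by
    intro γ hγ
    rw [Polynomial.smul_eq_C_mul,
      Polynomial.degree_C_mul (Finsupp.mem_support_iff.1 (Finset.mem_filter.1 hγ).1),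
      Polynomial.degree_eq_natDegree (monic_descPochhammer ℂ _).ne_zero,
      descPochhammer_natDegree]
  -- Within a fixed weight the first exponent determines the monomial, so the summands of `p` have
  -- distinct degrees and cannot cancel.
  have hle : (m : WithBot ℕ) ≤ p.degree := by
    have h1 : p.degree = s.sup fun γ => (c γ • descPochhammer ℂ γ.1).degree := by
      refine Polynomial.degree_sum_eq_of_disjoint _ _ ?_
      rintro γ ⟨hγ, -⟩ δ ⟨hδ, -⟩ hne he
      simp only [Function.comp, hdeg γ hγ, hdeg δ hδ, Nat.cast_inj] at he
      exact hne (by rw [hsk γ hγ, hsk δ hδ, he])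
    have h2 : (m, m + k) ∈ s :=
      Finset.mem_filter.2 ⟨Finsupp.mem_support_iff.2 hm, by simp [w]⟩
    rw [h1, ← hdeg _ h2]
    exact Finset.le_sup (f := fun γ => (c γ • descPochhammer ℂ γ.1).degree) h2
  have hp : p ≠ 0 := by
    rintro h
    rw [h, Polynomial.degree_zero] at hle
    simp at hle
  refine ⟨p, hp, ?_, ?_⟩
  · rwa [Polynomial.degree_eq_natDegree hp, Nat.cast_le] at hle
  · have e : y (-(k : ℤ)) = aeval num p * a ^ k := by
      simp only [y, p, map_sum, Finset.sum_mul, map_smul, smul_mul_assoc]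
      exact Finset.sum_congr rfl fun γ hγ => by rw [hsk γ hγ, mono_add_right]
    rwa [← e]

variable [FiniteDimensional ℂ V] (hbr : ∀ x ∈ V, ∀ y ∈ V, x * y - y * x ∈ V)
include hbr

/-- In a finite-dimensional commutator-closed subspace, a polynomial in `a†a` of degree at least two
excludes nonzero elements of nonzero weight. -/
theorem eq_zero_of_aeval_num_mem {D p : Polynomial ℂ} (hD : 2 ≤ D.natDegree)
    (hDV : aeval num D ∈ V) {k : ℕ} (hk : k ≠ 0) (hp : aeval num p * a ^ k ∈ V) : p = 0 := by
  by_contra hp0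
  let φ : Polynomial ℂ →ₗ[ℂ] Weyl := LinearMap.mulRight ℂ (a ^ k) ∘ₗ (aeval num).toLinearMap
  have hφ : Function.Injective φ :=
    (injective_iff_map_eq_zero φ).2 fun q hq => aeval_num_mul_a_pow_eq_zero hq
  -- `W` collects the polynomials q with q(N) a^k in V; it is finite-dimensional because `φ` is
  -- injective.
  let W := V.comap φ
  have : FiniteDimensional ℂ W := FiniteDimensional.of_injective
    (φ.restrict (p := W) (q := V) fun x hx => hx) fun x y h =>
      Subtype.ext (hφ (congrArg Subtype.val h))
  -- Since a^k D(N) = D(N + k) a^k, commuting with D(N) acts on `W` as multiplication by `Q`.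
  let Q := taylor (k : ℂ) D - D
  have hQ : ∀ q ∈ W, Q * q ∈ W := by
    intro q hq
    have h1 := hbr _ hq _ hDV
    have e : φ (Q * q) = φ q * aeval num D - aeval num D * φ q := by
      show aeval num (Q * q) * a ^ k
        = aeval num q * a ^ k * aeval num D - aeval num D * (aeval num q * a ^ k)
      rw [mul_assoc (aeval num q), a_pow_mul_aeval, ← mul_assoc, ← mul_assoc, ← map_mul,
        ← map_mul, ← sub_mul, ← map_sub]
      congr 2
      ring
    show φ (Q * q) ∈ V
    rw [e]
    exact h1
  have : Nontrivial W := ⟨⟨⟨p, hp⟩, 0, fun h => hp0 (congrArg Subtype.val h)⟩⟩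
  -- Multiplication by `Q` has an eigenvector over ℂ, and cancelling it makes `Q` constant. This
  -- contradicts deg Q = deg D - 1 ≥ 1.
  obtain ⟨μ, hμ⟩ := Module.End.exists_eigenvalue ((LinearMap.mulLeft ℂ Q).restrict hQ)
  obtain ⟨q, hq⟩ := hμ.exists_hasEigenvector
  have h1 : Q * (q : Polynomial ℂ) = μ • (q : Polynomial ℂ) := congrArg Subtype.val hq.apply_eq_smul
  rw [Polynomial.smul_eq_C_mul] at h1
  have h2 : Q = Polynomial.C μ :=
    mul_right_cancel₀ (fun h => hq.2 (Subtype.ext h)) h1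
  obtain ⟨d, hd⟩ : ∃ d, D.natDegree = d + 1 + 1 := ⟨D.natDegree - 2, by omega⟩
  have h3 := D.coeff_taylor_sub_ne_zero (k : ℂ) (Nat.cast_ne_zero.2 hk) (d + 1) hd
  exact h3 (by rw [show taylor (k : ℂ) D - D = Polynomial.C μ from h2]; simp)

variable (hstar : ∀ x ∈ V, star x ∈ V)
include hstar

/-- For x = p(N) a^k, the commutator [x, x†] is a difference F(N + k) - F(N) with deg F = 2 deg p +
k ≥ 3. It is thus a polynomial in N of degree at least two, to which `eq_zero_of_aeval_num_mem`
applies. -/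
theorem eq_zero_of_aeval_mul_a_pow_mem {p : Polynomial ℂ} {k : ℕ} (hk : k ≠ 0)
    (hd : 3 ≤ 2 * p.natDegree + k) (hp : aeval num p * a ^ k ∈ V) : p = 0 := by
  by_contra hp0
  set q := p.map (starRingEnd ℂ) with hq
  have hqd : q.natDegree = p.natDegree := Polynomial.natDegree_map _
  have hq0 : q ≠ 0 := (Polynomial.map_ne_zero_iff (starRingEnd ℂ).injective).2 hp0
  have h1 := hstar _ hp
  rw [star_mul, star_pow, star_a, star_aeval_num] at h1
  have h2 := hbr _ hp _ h1
  rw [commutator_aeval_mul_a_pow] at h2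
  set F := descPochhammer ℂ k * taylor (-(k : ℂ)) (p * q) with hF
  have hFd : F.natDegree = k + (p.natDegree + p.natDegree) := by
    rw [hF, Polynomial.natDegree_mul (monic_descPochhammer ℂ k).ne_zero
      ((Polynomial.taylor_injective _).ne_iff' (map_zero _) |>.2 (mul_ne_zero hp0 hq0)),
      descPochhammer_natDegree, Polynomial.natDegree_taylor, Polynomial.natDegree_mul hp0 hq0, hqd]
  have h3 := F.coeff_taylor_sub_ne_zero (k : ℂ) (Nat.cast_ne_zero.2 hk) (F.natDegree - 1) (by omega)
  have h4 := Polynomial.le_natDegree_of_ne_zero h3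
  exact hp0 (eq_zero_of_aeval_num_mem hbr (by omega) h2 hk hp)


end Components

theorem repr_star (x : Weyl) (γ : ℕ × ℕ) :
    monoBasis.repr (star x) γ = conj (monoBasis.repr x γ.swap) := by
  obtain ⟨l, rfl⟩ := monoBasis.repr.symm.surjective x
  rw [LinearEquiv.apply_symm_apply]
  induction l using Finsupp.induction_linear with
  | zero => simp
  | add f g hf hg =>
    rw [map_add, star_add, map_add, Finsupp.add_apply, hf, hg, Finsupp.add_apply, map_add]
  | single δ c =>
    rw [Module.Basis.repr_symm_single, monoBasis_apply, star_smul, star_mono, ← monoBasis_apply,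
      map_smul, Module.Basis.repr_self, Finsupp.smul_apply, Finsupp.single_apply,
      Finsupp.single_apply]
    have h : δ.swap = γ ↔ δ = γ.swap := by
      rw [← Prod.swap_swap γ, Prod.swap_injective.eq_iff, Prod.swap_swap]
    by_cases h' : δ = γ.swap <;> simp [h, h']

/-! ### Vanishing of coefficients -/

section Components

variable {V : Submodule ℂ Weyl} [FiniteDimensional ℂ V]
  (hbr : ∀ x ∈ V, ∀ y ∈ V, x * y - y * x ∈ V) (hstar : ∀ x ∈ V, star x ∈ V)
  (hN : ∀ x ∈ V, num * x - x * num ∈ V)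
include hbr hstar hN

theorem repr_eq_zero_of_three_le {x : Weyl} (hx : x ∈ V) {α β : ℕ} (hne : α ≠ β)
    (h3 : 3 ≤ α + β) : monoBasis.repr x (α, β) = 0 := by
  -- The dagger exchanges the two exponents and preserves V, so negative weight suffices.
  wlog h : α < β generalizing x α β
  · have h1 := this (hstar x hx) hne.symm (by omega) (by omega)
    rw [repr_star] at h1
    simpa using h1
  obtain ⟨k, rfl⟩ := Nat.exists_eq_add_of_lt h
  by_contra h0
  rw [add_assoc] at h0
  obtain ⟨p, hp, hd, hpV⟩ := exists_aeval_mul_a_pow_mem hN hx h0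
  exact hp (eq_zero_of_aeval_mul_a_pow_mem hbr hstar k.succ_ne_zero (by omega) hpV)

/-- The weight-zero component of `x` is a polynomial in N of degree at least k ≥ 2, which rules out
every component of nonzero weight. -/
theorem repr_eq_zero_of_diag {x y : Weyl} (hx : x ∈ V) (hy : y ∈ V) {k : ℕ} (hk : 2 ≤ k)
    (hxk : monoBasis.repr x (k, k) ≠ 0) {α β : ℕ} (hne : α ≠ β) :
    monoBasis.repr y (α, β) = 0 := by
  wlog h : α < β generalizing y α β
  · have h1 := this (hstar y hy) hne.symm (by omega)
    rw [repr_star] at h1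
    simpa using h1
  obtain ⟨D, -, hd, hDV⟩ := exists_aeval_mul_a_pow_mem (k := 0) hN hx hxk
  rw [pow_zero, mul_one] at hDV
  obtain ⟨j, rfl⟩ := Nat.exists_eq_add_of_lt h
  by_contra h0
  rw [add_assoc] at h0
  obtain ⟨p, hp, -, hpV⟩ := exists_aeval_mul_a_pow_mem hN hy h0
  exact hp (eq_zero_of_aeval_num_mem hbr (hk.trans hd) hDV j.succ_ne_zero hpV)

end Components

/-! ### Complexification of the real Lie algebra -/

theorem coe_lie (x y : Skew) : ((⁅x, y⁆ : Skew) : Weyl) = x * y - y * x := rfl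

/-- The complex span of a real Lie subalgebra of `Â₁`. -/
noncomputable def complexSpan (L : LieSubalgebra ℝ Skew) : Submodule ℂ Weyl :=
  Submodule.span ℂ (Subtype.val '' (L : Set Skew))

section ComplexSpan

variable {L : LieSubalgebra ℝ Skew}

theorem coe_mem_complexSpan {x : Skew} (hx : x ∈ L) : (x : Weyl) ∈ complexSpan L :=
  Submodule.subset_span ⟨x, hx, rfl⟩

theorem commutator_mem_complexSpan :
    ∀ x ∈ complexSpan L, ∀ y ∈ complexSpan L, x * y - y * x ∈ complexSpan L := by
  intro x hx y hy
  induction hx, hy using Submodule.span_induction₂ with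
  | mem_mem x y hx hy =>
    obtain ⟨x, hx, rfl⟩ := hx
    obtain ⟨y, hy, rfl⟩ := hy
    rw [← coe_lie]
    exact coe_mem_complexSpan (L.lie_mem hx hy)
  | zero_left y hy => simp
  | zero_right x hx => simp
  | add_left x y z _ _ _ h1 h2 =>
    rw [add_mul, mul_add, add_sub_add_comm]
    exact Submodule.add_mem _ h1 h2
  | add_right x y z _ _ _ h1 h2 =>
    rw [add_mul, mul_add, add_sub_add_comm]
    exact Submodule.add_mem _ h1 h2
  | smul_left r x y _ _ h =>
    rw [smul_mul_assoc, mul_smul_comm, ← smul_sub]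
    exact Submodule.smul_mem _ _ h
  | smul_right r x y _ _ h =>
    rw [smul_mul_assoc, mul_smul_comm, ← smul_sub]
    exact Submodule.smul_mem _ _ h

theorem star_mem_complexSpan : ∀ x ∈ complexSpan L, star x ∈ complexSpan L := by
  intro x hx
  induction hx using Submodule.span_induction with
  | mem x hx =>
    obtain ⟨x, hx, rfl⟩ := hx
    rw [show star (x : Weyl) = -x from x.2]
    exact Submodule.neg_mem _ (coe_mem_complexSpan hx)
  | zero => simp
  | add x y _ _ h1 h2 => rw [star_add]; exact Submodule.add_mem _ h1 h2
  | smul c x _ h => rw [star_smul]; exact Submodule.smul_mem _ _ h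

/-- The scalar ic is central, so commuting with the free term is i times commuting with N;
multiplying by -i, available only after complexification, removes the factor. -/
theorem num_commutator_mem_complexSpan {c : ℝ} (hc : freeTerm c ∈ L) :
    ∀ x ∈ complexSpan L, num * x - x * num ∈ complexSpan L := by
  intro x hx
  have h := Submodule.smul_mem _ (-Complex.I)
    (commutator_mem_complexSpan _ (coe_mem_complexSpan hc) x hx)
  have e : (freeTerm c : Weyl) = Complex.I • num + (Complex.I * (c : ℂ)) • (1 : Weyl) := rfl
  rw [e, add_mul, mul_add, smul_mul_assoc, mul_smul_comm, smul_mul_assoc, mul_smul_comm, one_mul,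
    mul_one, add_sub_add_right_eq_sub, ← smul_sub, smul_smul] at h
  simpa using h

instance [h : FiniteDimensional ℝ L] : FiniteDimensional ℂ (complexSpan L) := by
  have hL : Module.Finite ℝ L.toSubmodule := h
  obtain ⟨s, hs⟩ := Module.Finite.iff_fg.1 hL
  have : FiniteDimensional ℂ (Submodule.span ℂ (Subtype.val '' (s : Set Skew))) :=
    FiniteDimensional.span_of_finite ℂ (Set.toFinite _)
  refine Submodule.finiteDimensional_of_le (Submodule.span_le.2 ?_ :
    complexSpan L ≤ Submodule.span ℂ (Subtype.val '' (s : Set Skew)))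
  rintro _ ⟨x, hx, rfl⟩
  have hx' : x ∈ Submodule.span ℝ (s : Set Skew) := by rw [hs]; exact hx
  have hle : Submodule.span ℝ (s : Set Skew) ≤ (((Submodule.span ℂ
      (Subtype.val '' (s : Set Skew))).restrictScalars ℝ).comap Skew.toSubmodule.subtype) :=
    Submodule.span_le.2 fun y hy => Submodule.subset_span ⟨y, hy, rfl⟩
  exact hle hx'

end ComplexSpan

/-! ### Projections in terms of coefficients -/

section Projections

theorem genBasis_repr_eq_coeffFun (v : Skew) (i : Label) :
    genBasis.repr v i = coeffFun i v := by
  classical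
  have h : genBasis.coord i = coeffFun i := by
    refine genBasis.ext fun j => ?_
    rw [Module.Basis.coord_apply, Module.Basis.repr_self, Finsupp.single_apply, genBasis_apply]
    split_ifs with hij
    · rw [hij, coeffFun_gen_self]
    · rw [coeffFun_gen_of_ne i j (Ne.symm hij)]
  exact DFunLike.congr_fun h v

theorem coeffFun_eq_zero {v : Skew} {i : Label} (h : monoBasis.repr (v : Weyl) i.1.2 = 0) :
    coeffFun i v = 0 := by
  simp [coeffFun, h]

theorem proj_eq_zero_iff (S : Set Label) (v : Skew) :
    proj S v = 0 ↔ ∀ i ∈ S, coeffFun i v = 0 := by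
  classical
  rw [← genBasis.forall_coord_eq_zero_iff]
  refine forall_congr' fun i => ?_
  rw [Module.Basis.coord_apply, repr_proj, genBasis_repr_eq_coeffFun]
  simp

theorem image_proj_eq_zero_iff (S : Set Label) {G : Set Skew} (hG : G.Nonempty) :
    proj S '' G = {0} ↔ ∀ g ∈ G, ∀ i ∈ S, coeffFun i g = 0 := by
  rw [(hG.image _).subset_singleton_iff.symm, Set.image_subset_iff]
  exact forall₂_congr fun g _ => proj_eq_zero_iff S g

theorem mem_of_gen_mem (M : Submodule ℝ Skew) (v : Skew)
    (h : ∀ i, coeffFun i v ≠ 0 → gen i ∈ M) : v ∈ M := by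
  rw [← genBasis.linearCombination_repr v, Finsupp.linearCombination_apply]
  refine M.sum_mem fun i hi => M.smul_mem _ ?_
  rw [genBasis_apply]
  exact h i (by rwa [← genBasis_repr_eq_coeffFun, ← Finsupp.mem_support_iff])

end Projections

/-! ### Finite-dimensional Lie algebras for the converse -/

/-- The elements of `Â₁` lying in a complex subspace of the Weyl algebra. -/
noncomputable def skewPart (U : Submodule ℂ Weyl) : Submodule ℝ Skew :=
  (U.restrictScalars ℝ).comap Skew.toSubmodule.subtype

theorem gen_mem_skewPart {U : Submodule ℂ Weyl} {i : Label} (h1 : mono i.1.2 ∈ U)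
    (h2 : mono i.1.2.swap ∈ U) : gen i ∈ skewPart U := by
  rw [← star_mono] at h2
  rcases i with ⟨⟨_ | _, γ⟩, h⟩
  · exact U.sub_mem h2 h1
  · exact U.smul_mem _ (U.add_mem h2 h1)

/-- The span of `1`, `a` and `a†`. -/
noncomputable def linearPart : Submodule ℂ Weyl := Submodule.span ℂ {1, a, ad}

theorem commutator_linearPart {x y : Weyl} (hx : x ∈ linearPart) (hy : y ∈ linearPart) :
    ∃ c : ℂ, x * y - y * x = algebraMap ℂ Weyl c := by
  have h0 : a * ad - ad * a = 1 := by rw [a_mul_ad, add_sub_cancel_left]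
  suffices h : x * y - y * x ∈ (⊥ : Subalgebra ℂ Weyl) by
    obtain ⟨c, hc⟩ := Algebra.mem_bot.1 h
    exact ⟨c, hc.symm⟩
  induction hx, hy using Submodule.span_induction₂ with
  | mem_mem x y hx hy =>
    rcases hx with rfl | rfl | rfl <;> rcases hy with rfl | rfl | rfl
    · simp
    · simp
    · simp
    · simp
    · simp
    · rw [h0]; exact one_mem _
    · simp
    · rw [← neg_sub, h0]; exact neg_mem (one_mem _)
    · simp
  | zero_left y hy => simp
  | zero_right x hx => simp
  | add_left x y z _ _ _ h1 h2 =>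
    rw [add_mul, mul_add, add_sub_add_comm]
    exact add_mem h1 h2
  | add_right x y z _ _ _ h1 h2 =>
    rw [add_mul, mul_add, add_sub_add_comm]
    exact add_mem h1 h2
  | smul_left r x y _ _ h =>
    rw [smul_mul_assoc, mul_smul_comm, ← smul_sub]
    exact Subalgebra.smul_mem _ h _
  | smul_right r x y _ _ h =>
    rw [smul_mul_assoc, mul_smul_comm, ← smul_sub]
    exact Subalgebra.smul_mem _ h _

/-- By the Leibniz rule a commutator of products of two linear factors is a sum of such products,
each with a scalar commutator as coefficient. As 1 belongs to `linearPart`, the product space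
contains all terms of degree at most two. -/
theorem commutator_quadratic {x y : Weyl} (hx : x ∈ linearPart * linearPart)
    (hy : y ∈ linearPart * linearPart) : x * y - y * x ∈ linearPart * linearPart := by
  induction hx using Submodule.mul_induction_on' with
  | mem_mul_mem u hu v hv =>
    induction hy using Submodule.mul_induction_on' with
    | mem_mul_mem w hw z hz =>
      obtain ⟨c1, h1⟩ := commutator_linearPart hv hw
      obtain ⟨c2, h2⟩ := commutator_linearPart hv hz
      obtain ⟨c3, h3⟩ := commutator_linearPart hu hw
      obtain ⟨c4, h4⟩ := commutator_linearPart hu hz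
      -- The Leibniz expansion u[v,w]z + uw[v,z] + [u,w]zv + w[u,z]v, with the scalar commutators
      -- pulled to the front.
      have e : u * v * (w * z) - w * z * (u * v)
          = c1 • (u * z) + c2 • (u * w) + (c3 • (z * v) + c4 • (w * v)) := by
        simp only [Algebra.smul_def, ← h1, ← h2, ← h3, ← h4]
        have k1 : (v * w - w * v) * (u * z) = u * (v * w - w * v) * z := by
          rw [h1, ← mul_assoc, Algebra.commutes]
        have k2 : (v * z - z * v) * (u * w) = u * w * (v * z - z * v) := by
          rw [h2, Algebra.commutes]
        have k4 : (u * z - z * u) * (w * v) = w * (u * z - z * u) * v := by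
          rw [h4, ← mul_assoc, Algebra.commutes]
        rw [k1, k2, k4]
        noncomm_ring
      rw [e]
      refine add_mem (add_mem ?_ ?_) (add_mem ?_ ?_) <;>
        exact Submodule.smul_mem _ _ (Submodule.mul_mem_mul ‹_› ‹_›)
    | add y z _ _ h1 h2 =>
      rw [add_mul, mul_add, add_sub_add_comm]
      exact add_mem h1 h2
  | add y z _ _ h1 h2 =>
    rw [add_mul, mul_add, add_sub_add_comm]
    exact add_mem h1 h2

theorem finiteDimensional_skewPart (U : Submodule ℂ Weyl) [FiniteDimensional ℂ U] :
    FiniteDimensional ℝ (skewPart U) := by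
  have : FiniteDimensional ℝ U := FiniteDimensional.complexToReal U
  let f : skewPart U →ₗ[ℝ] U :=
    { toFun := fun x => ⟨x.1.1, x.2⟩
      map_add' := fun _ _ => rfl
      map_smul' := fun _ _ => rfl }
  exact FiniteDimensional.of_injective f fun x y h =>
    Subtype.ext (Subtype.ext (congrArg (fun z : U => (z : Weyl)) h))

theorem finiteDimensional_lieSpan_of_le {G : Set Skew} (K : LieSubalgebra ℝ Skew)
    [FiniteDimensional ℝ K] (h : G ⊆ K) :
    FiniteDimensional ℝ (LieSubalgebra.lieSpan ℝ Skew G) :=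
  FiniteDimensional.of_injective (LieSubalgebra.inclusion (LieSubalgebra.lieSpan_le.2 h)).toLinearMap
    (LieSubalgebra.inclusion_injective _)

theorem finiteDimensional_lieSpan_of_quadratic {G : Set Skew}
    (h : ∀ g ∈ G, ∀ i, coeffFun i g ≠ 0 → i ∈ labels0 ∪ (labels1 ∪ labels2)) :
    FiniteDimensional ℝ (LieSubalgebra.lieSpan ℝ Skew G) := by
  let K : LieSubalgebra ℝ Skew :=
    { skewPart (linearPart * linearPart) with
      lie_mem' := fun {x y} hx hy => commutator_quadratic (x := x) (y := y) hx hy }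
  have hfg : linearPart.FG := Submodule.fg_span (by simp)
  have : FiniteDimensional ℂ (linearPart * linearPart : Submodule ℂ Weyl) :=
    Module.Finite.iff_fg.2 (hfg.mul hfg)
  have : FiniteDimensional ℝ K := finiteDimensional_skewPart (linearPart * linearPart)
  refine finiteDimensional_lieSpan_of_le K fun g hg => mem_of_gen_mem _ g fun i hi => ?_
  have h1 : (1 : Weyl) ∈ linearPart := Submodule.subset_span (by simp)
  have ha : a ∈ linearPart := Submodule.subset_span (by simp)
  have had : ad ∈ linearPart := Submodule.subset_span (by simp)
  have key : mono i.1.2 ∈ linearPart * linearPart ∧ mono i.1.2.swap ∈ linearPart * linearPart := by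
    rcases h g hg i hi with (e | e) | e | e <;> change i.1.2 = _ at e <;> rw [e]
    · simpa [mono] using Submodule.mul_mem_mul h1 h1
    · simpa [mono] using Submodule.mul_mem_mul had ha
    · simpa [mono] using And.intro (Submodule.mul_mem_mul had h1) (Submodule.mul_mem_mul h1 ha)
    · simpa [mono, pow_two] using And.intro (Submodule.mul_mem_mul had had) (Submodule.mul_mem_mul ha ha)
  exact gen_mem_skewPart key.1 key.2

theorem finiteDimensional_lieSpan_of_diagonal {G : Set Skew} (hG : G.Finite)
    (h : ∀ g ∈ G, ∀ i, coeffFun i g ≠ 0 → i.1.2.1 = i.1.2.2) :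
    FiniteDimensional ℝ (LieSubalgebra.lieSpan ℝ Skew G) := by
  let M := skewPart (Polynomial.aeval num : Polynomial ℂ →ₐ[ℂ] Weyl).range.toSubmodule
  have hGM : Submodule.span ℝ G ≤ M := by
    refine Submodule.span_le.2 fun g hg => mem_of_gen_mem _ g fun i hi => ?_
    have e : i.1.2 = (i.1.2.1, i.1.2.1) := Prod.ext rfl (h g hg i hi).symm
    have h1 : mono (i.1.2.1, i.1.2.1)
        ∈ (Polynomial.aeval num : Polynomial ℂ →ₐ[ℂ] Weyl).range.toSubmodule :=
      ⟨_, (ad_pow_mul_a_pow i.1.2.1).symm⟩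
    rw [e.symm] at h1
    refine gen_mem_skewPart h1 ?_
    rw [e] at h1 ⊢
    exact h1
  -- Polynomials in N commute, so the linear span of `G` is already an abelian Lie algebra;
  -- finiteness of `G` bounds its dimension.
  let K : LieSubalgebra ℝ Skew :=
    { Submodule.span ℝ G with
      lie_mem' := fun {x y} hx hy => by
        obtain ⟨p, hp⟩ : ∃ p, Polynomial.aeval num p = (x : Weyl) := hGM hx
        obtain ⟨q, hq⟩ : ∃ q, Polynomial.aeval num q = (y : Weyl) := hGM hy
        have e : ⁅x, y⁆ = 0 := by
          apply Subtype.ext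
          rw [coe_lie, ← hp, ← hq, ← map_mul, ← map_mul, mul_comm, sub_self]
          rfl
        show ⁅x, y⁆ ∈ Submodule.span ℝ G
        rw [e]
        exact Submodule.zero_mem _ }
  have : FiniteDimensional ℝ K := FiniteDimensional.span_of_finite ℝ hG
  exact finiteDimensional_lieSpan_of_le K Submodule.subset_span

end Weyl

/-! ### The equivalence -/

theorem mainTheorem2 (c : ℝ) (G : Set Weyl.Skew) (hG : G.Finite) (hc : Weyl.freeTerm c ∈ G) :
    FiniteDimensional ℝ (LieSubalgebra.lieSpan ℝ Weyl.Skew G) ↔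
      Weyl.proj Weyl.labelsPerp '' G = {0} ∧
        (Weyl.proj Weyl.labelsEq '' G ≠ {0} →
          Weyl.proj (Weyl.labels1 ∪ Weyl.labels2) '' G = {0}) := by
  open Weyl in
  have hne : G.Nonempty := ⟨_, hc⟩
  rw [image_proj_eq_zero_iff _ hne, image_proj_eq_zero_iff _ hne, Ne, image_proj_eq_zero_iff _ hne]
  constructor
  · intro hfin
    have hN := num_commutator_mem_complexSpan (LieSubalgebra.subset_lieSpan (R := ℝ) hc)
    have hV : ∀ g ∈ G, (g : Weyl) ∈ complexSpan (LieSubalgebra.lieSpan ℝ Skew G) :=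
      fun g hg => coe_mem_complexSpan (LieSubalgebra.subset_lieSpan hg)
    refine ⟨fun g hg i hi => coeffFun_eq_zero ?_, fun hEq g hg i hi => coeffFun_eq_zero ?_⟩
    · exact repr_eq_zero_of_three_le commutator_mem_complexSpan star_mem_complexSpan hN (hV g hg)
        hi.1.ne' hi.2
    · push Not at hEq
      obtain ⟨x, hx, j, ⟨k, hk, hjk⟩, hxj⟩ := hEq
      have hxk : monoBasis.repr (x : Weyl) (k, k) ≠ 0 := by
        rw [← hjk]
        exact fun h => hxj (coeffFun_eq_zero h)
      -- The labels (1,0) and (2,0) have nonzero weight, so a diagonal term of order k ≥ 2 excludes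
      -- them.
      have hlt : i.1.2.1 ≠ i.1.2.2 := by
        rcases hi with e | e <;> simp [show i.1.2 = _ from e]
      exact repr_eq_zero_of_diag commutator_mem_complexSpan star_mem_complexSpan hN (hV x hx)
        (hV g hg) hk hxk hlt
  · rintro ⟨hperp, himp⟩
    -- Without Kerr-type terms the generators are quadratic; with one, condition (ii) leaves only
    -- diagonal terms.
    by_cases hEq : ∀ g ∈ G, ∀ i ∈ labelsEq, coeffFun i g = 0
    · refine finiteDimensional_lieSpan_of_quadratic fun g hg i hi => ?_
      have h1 : i ∉ labelsPerp := fun h => hi (hperp g hg i h)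
      have h2 : i ∉ labelsEq := fun h => hi (hEq g hg i h)
      rcases i with ⟨⟨s, α, β⟩, h3, h4⟩
      simp only [labelsPerp, labelsEq, labels0, labels1, labels2, Set.mem_union,
        Set.mem_ofPred_eq, Prod.mk.injEq, not_exists, not_and] at h1 h2 h3 ⊢
      -- Only k = α can witness membership in `labelsEq`.
      have h5 := h2 α
      omega
    · refine finiteDimensional_lieSpan_of_diagonal hG fun g hg i hi => ?_
      have h1 : i ∉ labelsPerp := fun h => hi (hperp g hg i h)
      have h2 : i ∉ labels1 ∪ labels2 := fun h => hi (himp hEq g hg i h)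
      rcases i with ⟨⟨s, α, β⟩, h3, h4⟩
      simp only [labelsPerp, labels1, labels2, Set.mem_union,
        Set.mem_ofPred_eq, Prod.mk.injEq, not_and] at h1 h2 h3 ⊢
      omega
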